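/- The class $EA$ of elementary amenable groups is the smallest class of groups that contains all finite and all abelian groups and is closed under taking subgroups, quotients, extensions and direct unions. Define classes $EG_\alpha$ of groups, for ordinals $\alpha$, by transfinite recursion: $EG_0$ is the class of all groups that are finite or abelian; $EG_{\alpha+1}$ is the class of groups $G$ that either have a normal subgroup $N$ with $N, G/N\in EG_\alpha$, or are the union of an upward directed family of subgroups belonging to $EG_\alpha$; and $EG_\alpha=\bigcup_{\beta<\alpha}EG_\beta$ if $\alpha$ is a limit ordinal. Every $G\in EA$ belongs to some $EG_\alpha$; the elementary class $\mathfrak c(G)$ of $G\in EA$ is the smallest ordinal $\alpha$ with $G\in EG_\alpha$. Let $\omega_1$ be the first uncountable ordinal. **Corollary 1.6.** Let $EA_c$ and $EA_{fg}$ be the classes of all countable elementary amenable groups and of all finitely generated elementary amenable groups, respectively. Then $$\{\mathfrak c(G)\mid G\in EA_c\}=\{\alpha+1\mid \alpha<\omega_1\}\cup\{0\}$$ and $$\{\mathfrak c(G)\mid G\in EA_{fg}\}=\{\alpha+2\mid \alpha<\omega_1\}\cup\{0,1\}.$$ -/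

import Mathlib

open scoped Ordinal

universe u

/-- `G` is an extension of a group in the class `P` by a group in the class `P`: it has a normal
subgroup in `P` whose quotient is in `P`. -/
def IsExtensionOf (P : ∀ (G : Type u) [Group G], Prop) (G : Type u) [Group G] : Prop :=
  ∃ (N : Subgroup G) (_ : N.Normal), P N ∧ P (G ⧸ N)

/-- `G` is a direct union of groups in the class `P`: it is the union of a family of subgroups
in `P` that is directed upwards by inclusion. -/
def IsDirectUnionOf (P : ∀ (G : Type u) [Group G], Prop) (G : Type u) [Group G] : Prop :=
  ∃ S : Set (Subgroup G), DirectedOn (· ≤ ·) S ∧ (∀ g : G, ∃ H ∈ S, g ∈ H) ∧ ∀ H ∈ S, P H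

/-- The elementary amenable groups: the smallest class of groups that contains all finite and all
abelian groups and is closed under taking subgroups, quotients, extensions and direct unions.
(Subgroups and quotients are taken up to isomorphism.) -/
inductive IsElementaryAmenable : ∀ (G : Type u) [Group G], Prop
  | of_finite (G : Type u) [Group G] : Finite G → IsElementaryAmenable G
  | of_comm (G : Type u) [Group G] : (∀ a b : G, a * b = b * a) → IsElementaryAmenable G
  | subgroup {G H : Type u} [Group G] [Group H] (f : H →* G) :
      Function.Injective f → IsElementaryAmenable G → IsElementaryAmenable H
  | quotient {G Q : Type u} [Group G] [Group Q] (f : G →* Q) :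
      Function.Surjective f → IsElementaryAmenable G → IsElementaryAmenable Q
  | extension {G : Type u} [Group G] (N : Subgroup G) [N.Normal] :
      IsElementaryAmenable N → IsElementaryAmenable (G ⧸ N) → IsElementaryAmenable G
  | directUnion {G : Type u} [Group G] (S : Set (Subgroup G)) :
      DirectedOn (· ≤ ·) S → (∀ g : G, ∃ H ∈ S, g ∈ H) →
      (∀ H ∈ S, IsElementaryAmenable H) → IsElementaryAmenable G

/-- The classes `EG α`, by transfinite recursion. `EG 0` consists of the finite groups and the
abelian groups; `EG (α + 1)` of the groups obtained from groups in `EG α` by one extension or one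
direct union; and `EG α` is the union of all `EG β` with `β < α` if `α` is a limit ordinal. -/
noncomputable def EG (α : Ordinal.{u}) : ∀ (G : Type u) [Group G], Prop :=
  Ordinal.limitRecOn (motive := fun _ => ∀ (G : Type u) [Group G], Prop) α
    (fun G _ => Finite G ∨ ∀ a b : G, a * b = b * a)
    (fun _ P G _ => IsExtensionOf P G ∨ IsDirectUnionOf P G)
    (fun α _ P G _ => ∃ (β : Ordinal.{u}) (h : β < α), P β h G)

/-- The elementary class of `G`: the smallest ordinal `α` with `G` in `EG α`. Such an ordinal
exists for every elementary amenable group, see `IsElementaryAmenable.exists_EG`. -/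
noncomputable def elementaryClass (G : Type u) [Group G] : Ordinal.{u} :=
  sInf {α | EG α G}

theorem EG_zero (G : Type u) [Group G] :
    EG 0 G ↔ Finite G ∨ ∀ a b : G, a * b = b * a := by
  simp only [EG, Ordinal.limitRecOn_zero]

theorem EG_add_one (α : Ordinal.{u}) (G : Type u) [Group G] :
    EG (α + 1) G ↔ IsExtensionOf (EG α) G ∨ IsDirectUnionOf (EG α) G := by
  unfold EG
  rw [Ordinal.limitRecOn_add_one]

theorem EG_limit {α : Ordinal.{u}} (hα : Order.IsSuccLimit α) (G : Type u) [Group G] :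
    EG α G ↔ ∃ β < α, EG β G := by
  unfold EG
  rw [Ordinal.limitRecOn_limit _ _ _ _ hα]
  simp only [exists_prop]

theorem EG_of_injective (α : Ordinal.{u}) : ∀ {G H : Type u} [Group G] [Group H] (f : H →* G),
    Function.Injective f → EG α G → EG α H := by
  induction α using Ordinal.limitRecOn with
  | zero =>
    intro G H _ _ f hf h
    rw [EG_zero] at h ⊢
    refine h.imp (fun (_ : Finite G) => Finite.of_injective f hf) (fun h a b => hf ?_)
    rw [map_mul, map_mul, h]
  | add_one α ih =>
    intro G H _ _ f hf h
    rw [EG_add_one] at h ⊢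
    refine h.imp ?_ ?_
    · rintro ⟨N, hN, h1, h2⟩
      refine ⟨N.comap f, inferInstance, ih (f.subgroupComap N) ?_ h1,
        ih (QuotientGroup.map (N.comap f) N f le_rfl) ?_ h2⟩
      · intro a b hab
        exact Subtype.ext (hf (congrArg Subtype.val hab))
      · rw [injective_iff_map_eq_one]
        intro a
        induction a using QuotientGroup.induction_on with
        | H a => simp [QuotientGroup.eq_one_iff]
    · rintro ⟨S, hS, hc, hP⟩
      refine ⟨Subgroup.comap f '' S, ?_, ?_, ?_⟩
      · rintro _ ⟨A, hA, rfl⟩ _ ⟨B, hB, rfl⟩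
        obtain ⟨C, hC, hAC, hBC⟩ := hS A hA B hB
        exact ⟨_, ⟨C, hC, rfl⟩, Subgroup.comap_mono hAC, Subgroup.comap_mono hBC⟩
      · intro g
        obtain ⟨K, hK, hg⟩ := hc (f g)
        exact ⟨_, ⟨K, hK, rfl⟩, hg⟩
      · rintro _ ⟨K, hK, rfl⟩
        refine ih (f.subgroupComap K) ?_ (hP K hK)
        intro a b hab
        exact Subtype.ext (hf (congrArg Subtype.val hab))
  | limit α hα ih =>
    intro G H _ _ f hf h
    rw [EG_limit hα] at h ⊢
    obtain ⟨β, hβ, h⟩ := h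
    exact ⟨β, hβ, ih β hβ f hf h⟩

theorem EG_of_surjective (α : Ordinal.{u}) : ∀ {G Q : Type u} [Group G] [Group Q] (f : G →* Q),
    Function.Surjective f → EG α G → EG α Q := by
  induction α using Ordinal.limitRecOn with
  | zero =>
    intro G Q _ _ f hf h
    rw [EG_zero] at h ⊢
    refine h.imp (fun (_ : Finite G) => Finite.of_surjective f hf) (fun h a b => ?_)
    obtain ⟨a, rfl⟩ := hf a
    obtain ⟨b, rfl⟩ := hf b
    rw [← map_mul, ← map_mul, h]
  | add_one α ih =>
    intro G Q _ _ f hf h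
    rw [EG_add_one] at h ⊢
    refine h.imp ?_ ?_
    · rintro ⟨N, hN, h1, h2⟩
      have hN' : (N.map f).Normal := hN.map f hf
      refine ⟨N.map f, hN', ih (f.subgroupMap N) (f.subgroupMap_surjective N) h1,
        ih (QuotientGroup.map N (N.map f) f (Subgroup.le_comap_map f N)) ?_ h2⟩
      intro q
      induction q using QuotientGroup.induction_on with
      | H q =>
        obtain ⟨g, rfl⟩ := hf q
        exact ⟨(g : G ⧸ N), rfl⟩
    · rintro ⟨S, hS, hc, hP⟩
      refine ⟨Subgroup.map f '' S, ?_, ?_, ?_⟩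
      · rintro _ ⟨A, hA, rfl⟩ _ ⟨B, hB, rfl⟩
        obtain ⟨C, hC, hAC, hBC⟩ := hS A hA B hB
        exact ⟨_, ⟨C, hC, rfl⟩, Subgroup.map_mono hAC, Subgroup.map_mono hBC⟩
      · intro q
        obtain ⟨g, rfl⟩ := hf q
        obtain ⟨K, hK, hg⟩ := hc g
        exact ⟨_, ⟨K, hK, rfl⟩, Subgroup.mem_map_of_mem f hg⟩
      · rintro _ ⟨K, hK, rfl⟩
        exact ih (f.subgroupMap K) (f.subgroupMap_surjective K) (hP K hK)
  | limit α hα ih =>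
    intro G Q _ _ f hf h
    rw [EG_limit hα] at h ⊢
    obtain ⟨β, hβ, h⟩ := h
    exact ⟨β, hβ, ih β hβ f hf h⟩

theorem EG_mono {α β : Ordinal.{u}} (hαβ : α ≤ β) {G : Type u} [Group G] (h : EG α G) :
    EG β G := by
  induction β using Ordinal.limitRecOn with
  | zero =>
    obtain rfl : α = 0 := le_antisymm hαβ (zero_le)
    exact h
  | add_one β ih =>
    rcases hαβ.eq_or_lt with rfl | hlt
    · exact h
    · rw [EG_add_one]
      refine Or.inr ⟨{⊤}, ?_, fun g => ⟨⊤, rfl, Subgroup.mem_top g⟩, ?_⟩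
      · rintro _ rfl _ rfl
        exact ⟨⊤, rfl, le_rfl, le_rfl⟩
      · rintro _ rfl
        exact EG_of_injective β (Subgroup.subtype _) Subtype.val_injective
          (ih (Order.lt_add_one_iff.mp hlt))
  | limit β hβ ih =>
    rcases hαβ.eq_or_lt with rfl | hlt
    · exact h
    · rw [EG_limit hβ]
      exact ⟨α, hlt, h⟩

/-- Every elementary amenable group lies in some `EG α`. -/
theorem IsElementaryAmenable.exists_EG {G : Type u} [Group G] (h : IsElementaryAmenable G) :
    ∃ α : Ordinal.{u}, EG α G := by
  induction h with
  | of_finite G h => exact ⟨0, (EG_zero G).mpr (Or.inl h)⟩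
  | of_comm G h => exact ⟨0, (EG_zero G).mpr (Or.inr h)⟩
  | subgroup f hf _ ih =>
    obtain ⟨α, hα⟩ := ih
    exact ⟨α, EG_of_injective α f hf hα⟩
  | quotient f hf _ ih =>
    obtain ⟨α, hα⟩ := ih
    exact ⟨α, EG_of_surjective α f hf hα⟩
  | extension N _ _ ih1 ih2 =>
    obtain ⟨α, hα⟩ := ih1
    obtain ⟨β, hβ⟩ := ih2
    exact ⟨max α β + 1, (EG_add_one _ _).mpr (Or.inl ⟨N, inferInstance,
      EG_mono (le_max_left _ _) hα, EG_mono (le_max_right _ _) hβ⟩)⟩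
  | directUnion S hS hc _ ih =>
    choose a ha using ih
    refine ⟨(⨆ H : S, a H.1 H.2) + 1, (EG_add_one _ _).mpr (Or.inr ⟨S, hS, hc, fun H hH => ?_⟩)⟩
    exact EG_mono (Ordinal.le_iSup (fun H : S => a H.1 H.2) ⟨H, hH⟩) (ha H hH)

/-! Upper bounds. By minimality a class is never a limit ordinal. For a countable group a direct
union can be thinned to an increasing sequence, so only countable ordinals are needed
(`exists_EG_lt_omega_one`). A finitely generated direct union equals one of its members, and at a
limit `α` the class `EG α` is closed under extensions; hence a finitely generated group never has
class `α + 1` with `α` a limit (`EG_limit_of_fg`).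

Realization is by transfinite induction (`exists_fg_powersEG_add_two`). The wreath product of a
finitely generated group with itself raises the class by one. The upper bound concerns a restricted
power in the base, so the induction carries `PowersEG` instead of mere membership. At a limit `α`, a
restricted product of countable groups of cofinal classes is a countable locally `EG α` group `H`
outside `EG α`, hence of class `α + 1`. To get class `α + 2`, the derived subgroup of `H` is
embedded in a finitely generated subgroup of the unrestricted wreath product of `H` by `ℤ`,
generated by `ℤ` and one function listing `H` along a Sidon sequence. Two distinct translates of
that function meet in at most one point, so its base part stays locally `EG α`. -/

/-! ### Extensions, finite generation and the possible classes -/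

theorem EG_of_comm {G : Type u} [Group G] (α : Ordinal.{u}) (h : ∀ a b : G, a * b = b * a) :
    EG α G :=
  EG_mono (zero_le) ((EG_zero G).mpr (Or.inr h))

/-- A group mapping to a group in `EG α` with kernel in `EG α` lies in `EG (α + 1)`. -/
theorem EG_add_one_of_hom {α : Ordinal.{u}} {G Q : Type u} [Group G] [Group Q] (f : G →* Q)
    (hk : EG α f.ker) (hQ : EG α Q) : EG (α + 1) G :=
  (EG_add_one α G).mpr (Or.inl ⟨f.ker, inferInstance, hk,
    EG_of_injective α (QuotientGroup.kerLift f) (QuotientGroup.kerLift_injective f) hQ⟩)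

/-- For limit `α`, the class `EG α` is closed under extensions. -/
theorem EG_limit_of_hom {α : Ordinal.{u}} (hα : Order.IsSuccLimit α) {G Q : Type u} [Group G]
    [Group Q] (f : G →* Q) (hk : EG α f.ker) (hQ : EG α Q) : EG α G := by
  obtain ⟨β, hβ, hk⟩ := (EG_limit hα _).mp hk
  obtain ⟨γ, hγ, hQ⟩ := (EG_limit hα _).mp hQ
  refine (EG_limit hα _).mpr ⟨max β γ + 1, hα.add_one_lt (max_lt hβ hγ), ?_⟩
  exact EG_add_one_of_hom f (EG_mono (le_max_left _ _) hk) (EG_mono (le_max_right _ _) hQ)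

/-- A finitely generated group in `EG (α + 1)` is an extension of groups in `EG α`, unless it
already lies in `EG α`. -/
theorem EG_or_extension_of_fg {α : Ordinal.{u}} {G : Type u} [Group G] [hG : Group.FG G]
    (h : EG (α + 1) G) : EG α G ∨ IsExtensionOf (EG α) G := by
  rcases (EG_add_one α G).mp h with h | ⟨S, hS, hc, hP⟩
  · exact Or.inr h
  · left
    obtain ⟨t, ht⟩ := hG.out
    classical
    -- By directedness one member of the family contains a whole finite generating set.
    have key : ∀ s : Finset G, ∃ H ∈ S, (s : Set G) ⊆ H := by
      intro s
      induction s using Finset.induction_on with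
      | empty =>
        obtain ⟨H, hH, _⟩ := hc 1
        exact ⟨H, hH, by simp⟩
      | insert a s _ ih =>
        obtain ⟨A, hA, hs⟩ := ih
        obtain ⟨B, hB, ha⟩ := hc a
        obtain ⟨C, hC, hAC, hBC⟩ := hS A hA B hB
        refine ⟨C, hC, ?_⟩
        rw [Finset.coe_insert, Set.insert_subset_iff]
        exact ⟨hBC ha, fun x hx => hAC (hs hx)⟩
    obtain ⟨H, hH, htH⟩ := key t
    have hT : H = ⊤ := by
      rw [eq_top_iff, ← ht]
      exact (Subgroup.closure_le H).mpr htH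
    subst hT
    exact EG_of_surjective α (Subgroup.topEquiv (G := G)).toMonoidHom
      (Subgroup.topEquiv (G := G)).surjective (hP _ hH)

/-- For limit `α`, a finitely generated group in `EG (α + 1)` lies in `EG α`. -/
theorem EG_limit_of_fg {α : Ordinal.{u}} (hα : Order.IsSuccLimit α) {G : Type u} [Group G]
    [hG : Group.FG G] (h : EG (α + 1) G) : EG α G := by
  rcases EG_or_extension_of_fg h with h | ⟨N, hN, h1, h2⟩
  · exact h
  · refine EG_limit_of_hom hα (QuotientGroup.mk' N) ?_ h2
    rwa [QuotientGroup.ker_mk']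

theorem EG.isElementaryAmenable {α : Ordinal.{u}} {G : Type u} [inst : Group G] (h : EG α G) :
    IsElementaryAmenable G := by
  induction α using Ordinal.limitRecOn generalizing G with
  | zero =>
    rcases (EG_zero G).mp h with h | h
    · exact .of_finite G h
    · exact .of_comm G h
  | add_one α ih =>
    rcases (EG_add_one α G).mp h with ⟨N, hN, h1, h2⟩ | ⟨S, hS, hc, hP⟩
    · exact .extension N (ih h1) (ih h2)
    · exact .directUnion S hS hc fun H hH => ih (hP H hH)
  | limit α hα ih =>
    obtain ⟨β, hβ, h⟩ := (EG_limit hα _).mp h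
    exact ih β hβ h

theorem elementaryClass_le {α : Ordinal.{u}} {G : Type u} [Group G] (h : EG α G) :
    elementaryClass G ≤ α :=
  csInf_le' h

theorem IsElementaryAmenable.EG_elementaryClass {G : Type u} [Group G]
    (h : IsElementaryAmenable G) : EG (elementaryClass G) G :=
  csInf_mem (s := {α | EG α G}) h.exists_EG

theorem elementaryClass_eq_add_one {α : Ordinal.{u}} {G : Type u} [Group G] (h : EG (α + 1) G)
    (h' : ¬ EG α G) : elementaryClass G = α + 1 := by
  refine le_antisymm (elementaryClass_le h) (Order.add_one_le_of_lt ?_)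
  by_contra hlt
  exact h' (EG_mono (not_lt.mp hlt) h.isElementaryAmenable.EG_elementaryClass)

theorem not_isSuccLimit_elementaryClass {G : Type u} [Group G] (h : IsElementaryAmenable G) :
    ¬ Order.IsSuccLimit (elementaryClass G) := by
  intro hl
  obtain ⟨β, hβ, h⟩ := (EG_limit hl _).mp h.EG_elementaryClass
  exact (elementaryClass_le h).not_gt hβ

/-- A countable elementary amenable group has countable elementary class. -/
theorem exists_EG_lt_omega_one {α : Ordinal.{u}} {G : Type u} [Group G] [Countable G]
    (h : EG α G) : ∃ β < ω₁, EG β G := by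
  have hlim : Order.IsSuccLimit (ω₁ : Ordinal.{u}) := Cardinal.isSuccLimit_omega 1
  induction α using Ordinal.limitRecOn generalizing G with
  | zero => exact ⟨0, hlim.bot_lt, h⟩
  | add_one α ih =>
    rcases (EG_add_one α G).mp h with ⟨N, hN, h1, h2⟩ | ⟨S, hS, hc, hP⟩
    · have : Countable (G ⧸ N) := Quotient.countable
      obtain ⟨β, hβ, h1⟩ := ih h1
      obtain ⟨γ, hγ, h2⟩ := ih h2
      refine ⟨max β γ + 1, hlim.add_one_lt (max_lt hβ hγ), (EG_add_one _ _).mpr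
        (Or.inl ⟨N, hN, EG_mono (le_max_left _ _) h1, EG_mono (le_max_right _ _) h2⟩)⟩
    -- The family may be uncountable; absorbing the elements of `G` one at a time gives a chain in
    -- `S` indexed by `ℕ` that still exhausts `G`, and countably many ordinals below `ω₁` have their
    -- supremum below `ω₁`.
    · obtain ⟨e, he⟩ := exists_surjective_nat G
      have hstep : ∀ (H : S) (g : G), ∃ K : S, H.1 ≤ K.1 ∧ g ∈ K.1 := by
        rintro ⟨H, hH⟩ g
        obtain ⟨K, hK, hg⟩ := hc g
        obtain ⟨C, hC, h1, h2⟩ := hS H hH K hK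
        exact ⟨⟨C, hC⟩, h1, h2 hg⟩
      choose next hle hmem using hstep
      obtain ⟨H₀, hH₀, _⟩ := hc 1
      let chain : ℕ → S := fun n => Nat.rec ⟨H₀, hH₀⟩ (fun n H => next H (e n)) n
      have hmono : Monotone fun n => (chain n).1 := monotone_nat_of_le_succ fun n => hle _ _
      have hcl : ∀ n, ∃ β < ω₁, EG β (chain n).1 := fun n => ih (hP _ (chain n).2)
      choose b hb hEG using hcl
      refine ⟨(⨆ n, b n) + 1, hlim.add_one_lt (Ordinal.iSup_lt_omega_one hb),
        (EG_add_one _ _).mpr (Or.inr ⟨Set.range fun n => (chain n).1, hmono.directed_le.directedOn_range,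
          fun g => ?_, ?_⟩)⟩
      · obtain ⟨n, rfl⟩ := he g
        exact ⟨_, ⟨n + 1, rfl⟩, hmem (chain n) (e n)⟩
      · rintro _ ⟨n, rfl⟩
        exact EG_mono (Ordinal.le_iSup b n) (hEG n)
  | limit α hα ih =>
    obtain ⟨β, hβ, h⟩ := (EG_limit hα _).mp h
    exact ih β hβ h

theorem Group.FG.countable (G : Type*) [Group G] [h : Group.FG G] : Countable G := by
  obtain ⟨s, hs, f, hf⟩ := Group.fg_iff_exists_freeGroup_hom_surjective_finite.mp h
  have : Countable (FreeGroup s) := inferInstanceAs (Countable (Quot _))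
  exact hf.countable

/-! ### Restricted products and locally `EG α` groups -/

/-- The restricted direct product of a family of groups. -/
def restrictedPi {ι : Type*} (G : ι → Type*) [∀ i, Group (G i)] : Subgroup (∀ i, G i) where
  carrier := {f | {i | f i ≠ 1}.Finite}
  one_mem' := by simp
  mul_mem' {a b} ha hb := by
    refine (Set.Finite.union ha hb).subset fun i hi => ?_
    by_contra h
    simp only [Set.mem_union, Set.mem_ofPred_eq, not_or, not_not] at h
    exact hi (by simp [h.1, h.2])
  inv_mem' {a} ha := by simpa using ha

/-- All groups generated by finitely many elements of `G` lie in `EG α`. -/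
def IsLocallyEG (α : Ordinal.{u}) (G : Type u) [Group G] : Prop :=
  ∀ t : Set G, t.Finite → EG α (Subgroup.closure t)

theorem IsLocallyEG.succ {α : Ordinal.{u}} {G : Type u} [Group G] (h : IsLocallyEG α G) :
    EG (α + 1) G := by
  refine (EG_add_one α G).mpr (Or.inr
    ⟨Subgroup.closure '' {t : Set G | t.Finite}, ?_, fun g => ?_, ?_⟩)
  · rintro _ ⟨s, hs, rfl⟩ _ ⟨t, ht, rfl⟩
    exact ⟨_, ⟨s ∪ t, Set.Finite.union hs ht, rfl⟩,
      Subgroup.closure_mono Set.subset_union_left, Subgroup.closure_mono Set.subset_union_right⟩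
  · exact ⟨_, ⟨{g}, Set.finite_singleton g, rfl⟩, Subgroup.subset_closure rfl⟩
  · rintro _ ⟨t, ht, rfl⟩
    exact h t ht

/-- If `f` is injective and maps `A` into `B`, then the class of `A` is at most that of `B`. -/
theorem EG_of_map_le {α : Ordinal.{u}} {G H : Type u} [Group G] [Group H] (f : G →* H)
    (hf : Function.Injective f) {A : Subgroup G} {B : Subgroup H} (hAB : A.map f ≤ B)
    (h : EG α B) : EG α A := by
  refine EG_of_injective α ((f.comp A.subtype).codRestrict B
    fun x => hAB (Subgroup.mem_map_of_mem f x.2)) ?_ h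
  intro a b hab
  exact Subtype.ext (hf (congrArg Subtype.val hab))

/-- For limit `α`, the class `EG α` is closed under finite direct products. -/
theorem EG_limit_pi {α : Ordinal.{u}} (hα : Order.IsSuccLimit α) (ι : Type u) [Finite ι] :
    ∀ (G : ι → Type u) [∀ i, Group (G i)], (∀ i, EG α (G i)) → EG α (∀ i, G i) := by
  induction ι using Finite.induction_empty_option with
  | of_equiv e ih =>
    intro G _ h
    refine EG_of_injective α (MonoidHom.pi fun a => Pi.evalMonoidHom G (e a)) (fun f g hfg =>
      funext fun i => ?_) (ih (fun a => G (e a)) fun a => h _)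
    obtain ⟨a, rfl⟩ := e.surjective i
    exact congrFun hfg a
  | h_empty =>
    intro G _ _
    exact EG_of_comm α fun a b => Subsingleton.elim _ _
  | h_option ih =>
    intro G _ h
    let r : (∀ i, G i) →* ∀ i, G (some i) := MonoidHom.pi fun i => Pi.evalMonoidHom G (some i)
    refine EG_limit_of_hom hα r ?_ (ih _ fun i => h _)
    refine EG_of_injective α ((Pi.evalMonoidHom G none).comp r.ker.subtype) ?_ (h none)
    rw [injective_iff_map_eq_one]
    rintro ⟨f, hf⟩ h1
    refine Subtype.ext (funext fun i => ?_)
    rcases i with _ | i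
    · exact h1
    · exact congrFun hf i

theorem IsLocallyEG.of_injective {α : Ordinal.{u}} {G H : Type u} [Group G] [Group H] (f : G →* H)
    (hf : Function.Injective f) (h : IsLocallyEG α H) : IsLocallyEG α G := fun t ht =>
  EG_of_map_le f hf (MonoidHom.map_closure f t).le (h _ (ht.image f))

/-- For limit `α`, the locally `EG α` groups are closed under restricted direct products. -/
theorem IsLocallyEG.pi {α : Ordinal.{u}} (hα : Order.IsSuccLimit α) {ι : Type u}
    {G : ι → Type u} [∀ i, Group (G i)] (h : ∀ i, IsLocallyEG α (G i)) :
    IsLocallyEG α (restrictedPi G) := by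
  intro t ht
  let ev : ∀ i, restrictedPi G →* G i := fun i =>
    (Pi.evalMonoidHom G i).comp (restrictedPi G).subtype
  -- All supports of generators lie in the finite set `J`, so the generated group embeds in a finite
  -- product.
  let J : Set ι := ⋃ f ∈ t, {i | f.1 i ≠ 1}
  have : Finite J := ht.biUnion fun f _ => f.2
  let r : Subgroup.closure t →* ∀ j : J, Subgroup.closure (ev j '' t) :=
    MonoidHom.pi fun j => ((ev j).comp (Subgroup.closure t).subtype).codRestrict _ fun x =>
      (MonoidHom.map_closure (ev j) t).le (Subgroup.mem_map_of_mem _ x.2)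
  refine EG_of_injective α r ?_ (EG_limit_pi hα J _ fun j => h j _ (ht.image _))
  rw [injective_iff_map_eq_one]
  intro x hx
  refine Subtype.ext (Subtype.ext (funext fun i => ?_))
  by_cases hi : i ∈ J
  · exact congrArg Subtype.val (congrFun hx ⟨i, hi⟩)
  · have : Subgroup.closure t ≤ (ev i).ker := by
      rw [Subgroup.closure_le]
      intro f hf
      by_contra hne
      exact hi (Set.mem_biUnion hf hne)
    exact this x.2

/-- The restricted direct powers of `G` lie in `EG α`. -/
def PowersEG (α : Ordinal.{u}) (G : Type u) [Group G] : Prop :=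
  ∀ ι : Type u, EG α (restrictedPi fun _ : ι => G)

theorem PowersEG.toEG {α : Ordinal.{u}} {G : Type u} [Group G] (h : PowersEG α G) : EG α G := by
  refine EG_of_injective α (MonoidHom.mk' (fun g => ⟨fun _ => g, Set.toFinite _⟩)
    fun _ _ => rfl) ?_ (h PUnit)
  intro a b hab
  exact congrFun (congrArg Subtype.val hab) PUnit.unit

/-- The map of restricted direct powers induced by a homomorphism. -/
def restrictedPiMap (ι : Type*) {G H : Type*} [Group G] [Group H] (f : G →* H) :
    (restrictedPi fun _ : ι => G) →* restrictedPi fun _ : ι => H where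
  toFun x := ⟨fun i => f (x.1 i), x.2.subset fun i hi h => hi (by simp [h])⟩
  map_one' := Subtype.ext (funext fun _ => map_one f)
  map_mul' x y := Subtype.ext (funext fun _ => map_mul f _ _)

/-- The restricted powers of an extension of a group by `Q` are in `EG (α + 1)` if those of `Q`
and those of the kernel are in `EG α`. -/
theorem PowersEG.of_hom {α : Ordinal.{u}} {G Q : Type u} [Group G] [Group Q] (f : G →* Q)
    (hk : PowersEG α f.ker) (hQ : PowersEG α Q) : PowersEG (α + 1) G := by
  intro ι
  refine EG_add_one_of_hom (restrictedPiMap ι f) ?_ (hQ ι)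
  let g : (restrictedPiMap ι f).ker →* restrictedPi fun _ : ι => f.ker :=
    { toFun := fun x => ⟨fun i => ⟨x.1.1 i, congrFun (congrArg Subtype.val x.2) i⟩,
        x.1.2.subset fun i hi h => hi (Subtype.ext h)⟩
      map_one' := rfl
      map_mul' := fun _ _ => rfl }
  refine EG_of_injective α g (fun x y hxy => ?_) (hk ι)
  refine Subtype.ext (Subtype.ext (funext fun i => ?_))
  exact congrArg Subtype.val (congrFun (congrArg Subtype.val hxy) i)

theorem PowersEG.of_injective {α : Ordinal.{u}} {G H : Type u} [Group G] [Group H] (f : G →* H)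
    (hf : Function.Injective f) (h : PowersEG α H) : PowersEG α G := fun ι =>
  EG_of_injective α (restrictedPiMap ι f) (fun _ _ hxy => Subtype.ext (funext fun i =>
    hf (congrFun (congrArg Subtype.val hxy) i))) (h ι)

theorem PowersEG.of_comm {G : Type u} [Group G] (α : Ordinal.{u}) (h : ∀ a b : G, a * b = b * a) :
    PowersEG α G := fun _ =>
  EG_of_comm α fun _ _ => Subtype.ext (funext fun _ => h _ _)

/-- Restricted powers of restricted powers are restricted powers. -/
theorem PowersEG.pow {α : Ordinal.{u}} {G : Type u} [Group G] (h : PowersEG α G)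
    (ι : Type u) : PowersEG α (restrictedPi fun _ : ι => G) := by
  intro κ
  let g : (restrictedPi fun _ : κ => restrictedPi fun _ : ι => G) →*
      restrictedPi fun _ : κ × ι => G :=
    { toFun := fun x => ⟨fun p => (x.1 p.1).1 p.2, by
        refine ((x.2 : Set.Finite _).biUnion fun k _ => ((x.1 k).2 : Set.Finite _).image
          (Prod.mk k)).subset ?_
        rintro ⟨k, i⟩ hki
        refine Set.mem_biUnion (x := k) (fun h1 => hki ?_) ⟨i, hki, rfl⟩
        simp [h1]⟩
      map_one' := rfl
      map_mul' := fun _ _ => rfl }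
  refine EG_of_injective α g (fun x y hxy => ?_) (h (κ × ι))
  refine Subtype.ext (funext fun k => Subtype.ext (funext fun i => ?_))
  exact congrFun (congrArg Subtype.val hxy) (k, i)

/-! ### Restricted wreath products: the successor step -/

namespace RegularWreathProduct

variable {D Q : Type u} [Group D] [Group Q]

open Classical in
/-- The embedding of `D` into the wreath product as the functions supported at `1`. -/
noncomputable def single (D Q : Type u) [Group D] [Group Q] : D →* D ≀ᵣ Q where
  toFun d := ⟨Pi.mulSingle 1 d, 1⟩
  map_one' := by ext <;> simp
  map_mul' a b := by ext <;> simp [Pi.mulSingle_mul]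

theorem single_left_one (d : D) : (single D Q d).left 1 = d := by
  simp [single]

theorem single_left_of_ne (d : D) {q : Q} (hq : q ≠ 1) : (single D Q d).left q = 1 := by
  simp [single, hq]

@[simp]
theorem single_right (d : D) : (single D Q d).right = 1 := rfl

/-- The base functions of the elements of a subgroup of a wreath product with trivial
`Q`-component. -/
def kerLeft (W : Subgroup (D ≀ᵣ Q)) : (rightHom.comp W.subtype).ker →* (Q → D) where
  toFun x := x.1.1.left
  map_one' := rfl
  map_mul' x y := by
    have hx : x.1.1.right = 1 := x.2
    ext q
    simp [hx]

theorem kerLeft_injective (W : Subgroup (D ≀ᵣ Q)) : Function.Injective (kerLeft W) := by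
  intro x y hxy
  have hx : x.1.1.right = 1 := x.2
  have hy : y.1.1.right = 1 := y.2
  exact Subtype.ext (Subtype.ext (RegularWreathProduct.ext hxy (hx.trans hy.symm)))

/-- The elements of the wreath product whose base function lies in a translation invariant
subgroup. -/
def ofInvariant (B : Subgroup (Q → D)) (hB : ∀ f ∈ B, ∀ q : Q, (fun x => f (q * x)) ∈ B) :
    Subgroup (D ≀ᵣ Q) where
  carrier := {w | w.left ∈ B}
  one_mem' := B.one_mem
  mul_mem' ha hb := B.mul_mem ha (hB _ hb _)
  inv_mem' ha := hB _ (B.inv_mem ha) _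

/-- The restricted regular wreath product. -/
noncomputable def restricted (D Q : Type u) [Group D] [Group Q] : Subgroup (D ≀ᵣ Q) :=
  (single D Q).range ⊔ inl.range

instance fg_restricted [Group.FG D] [Group.FG Q] : Group.FG (restricted D Q) := by
  rw [Group.fg_iff_subgroup_fg]
  exact ((Group.fg_iff_subgroup_fg _).mp inferInstance).sup
    ((Group.fg_iff_subgroup_fg _).mp inferInstance)

theorem restricted_left_mem {w : D ≀ᵣ Q} (hw : w ∈ restricted D Q) :
    w.left ∈ restrictedPi fun _ : Q => D := by
  have hB : ∀ f ∈ restrictedPi (fun _ : Q => D), ∀ q : Q,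
      (fun x => f (q * x)) ∈ restrictedPi fun _ : Q => D := fun f hf q =>
    Set.Finite.preimage (mul_right_injective q).injOn hf
  have : restricted D Q ≤ ofInvariant _ hB := by
    refine sup_le ?_ ?_
    · rintro _ ⟨d, rfl⟩
      refine (Set.finite_singleton (1 : Q)).subset fun q hq => ?_
      by_contra h
      exact hq (single_left_of_ne d h)
    · rintro _ ⟨q, rfl⟩
      exact (restrictedPi fun _ : Q => D).one_mem
  exact this hw

/-- The kernel of the projection to `Q` embeds in a restricted power of `D`, whose own restricted
powers are again restricted powers of `D`. -/
theorem powersEG_restricted {α : Ordinal.{u}} (hD : PowersEG α D) (hQ : PowersEG α Q) :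
    PowersEG (α + 1) (restricted D Q) :=
  PowersEG.of_hom (rightHom.comp (restricted D Q).subtype)
    (PowersEG.of_injective ((kerLeft (restricted D Q)).codRestrict (restrictedPi fun _ : Q => D)
      fun x => restricted_left_mem x.1.2)
      (fun _ _ hxy => kerLeft_injective _ (congrArg Subtype.val hxy)) (hD.pow Q)) hQ

theorem restricted_rightHom_surjective :
    Function.Surjective ((rightHom (D := D)).comp (restricted D Q).subtype) := fun q =>
  ⟨⟨inl q, Subgroup.mem_sup_right ⟨q, rfl⟩⟩, rfl⟩

/-- If neither `D` nor `Q` lies in `EG α`, then their wreath product is no extension of groups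
in `EG α`: a normal subgroup in the base has the quotient `Q`, and any other one contains enough
commutators to map onto `D`. -/
theorem not_isExtensionOf_restricted {α : Ordinal.{u}} (hD : ¬ EG α D) (hQ : ¬ EG α Q) :
    ¬ IsExtensionOf (EG α) (restricted D Q) := by
  rintro ⟨N, hN, h1, h2⟩
  let f := (rightHom (D := D)).comp (restricted D Q).subtype
  by_cases hle : N ≤ f.ker
  · refine hQ (EG_of_surjective α (QuotientGroup.lift N f hle) ?_ h2)
    intro q
    obtain ⟨w, hw⟩ := restricted_rightHom_surjective (D := D) q
    exact ⟨(w : restricted D Q ⧸ N), hw⟩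
  · obtain ⟨n, hn, hne⟩ := SetLike.not_le_iff_exists.mp hle
    replace hne : n.1.right ≠ 1 := hne
    let g : (N.comap f.ker.subtype : Subgroup f.ker) →* D :=
      ((Pi.evalMonoidHom (fun _ : Q => D) 1).comp (kerLeft (restricted D Q))).comp
        (N.comap f.ker.subtype).subtype
    refine hD (EG_of_surjective α g ?_ (EG_of_injective α
      ((f.ker.subtype.comp (N.comap f.ker.subtype).subtype).codRestrict N fun x => x.2) ?_ h1))
    · intro d
      let s : restricted D Q := ⟨single D Q d, Subgroup.mem_sup_left ⟨d, rfl⟩⟩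
      have hs : s.1 = single D Q d := rfl
      -- Conjugation by `n` moves the support of `s` away from `1`, so the commutator lies in the
      -- base and has value `d` at `1`.
      have hmem : s * n * s⁻¹ * n⁻¹ ∈ N := N.mul_mem (hN.conj_mem n hn s) (N.inv_mem hn)
      have hker : s * n * s⁻¹ * n⁻¹ ∈ f.ker := by
        rw [MonoidHom.mem_ker]
        have : f s = 1 := rfl
        simp [this]
      refine ⟨⟨⟨_, hker⟩, hmem⟩, ?_⟩
      change (s * n * s⁻¹ * n⁻¹).1.left 1 = d
      have hne' : n.1.right⁻¹ ≠ 1 := inv_ne_one.mpr hne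
      simp [hs, single_left_one, single_left_of_ne _ hne']
    · intro x y hxy
      have h : x.1.1 = y.1.1 := congrArg (fun z : N => z.1) hxy
      exact Subtype.ext (Subtype.ext h)

/-- Finite generation rules out a proper direct union, and membership in `EG α` would pass to the
quotient `Q`. -/
theorem not_EG_restricted [Group.FG D] [Group.FG Q] {α : Ordinal.{u}} (hD : ¬ EG α D)
    (hQ : ¬ EG α Q) : ¬ EG (α + 1) (restricted D Q) := by
  intro h
  rcases EG_or_extension_of_fg h with h | h
  · exact hQ (EG_of_surjective α _ restricted_rightHom_surjective h)
  · exact not_isExtensionOf_restricted hD hQ h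

/-- The wreath product of a nontrivial group by an infinite group is neither finite nor abelian. -/
theorem not_EG_zero_restricted [Nontrivial D] [Infinite Q] : ¬ EG 0 (restricted D Q) := by
  rw [EG_zero]
  rintro (h | h)
  · exact not_finite_iff_infinite.mpr (Infinite.of_surjective _
      (restricted_rightHom_surjective (D := D) (Q := Q))) h
  · obtain ⟨d, hd⟩ := exists_ne (1 : D)
    obtain ⟨q, hq⟩ := exists_ne (1 : Q)
    have := h ⟨single D Q d, Subgroup.mem_sup_left ⟨d, rfl⟩⟩
      ⟨inl q, Subgroup.mem_sup_right ⟨q, rfl⟩⟩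
    have := congrFun (congrArg (fun w => w.1.left) this) 1
    simp [single_left_one, single_left_of_ne _ (inv_ne_one.mpr hq)] at this
    exact hd this

end RegularWreathProduct

/-! ### Sidon sequences and sparse wreath products: the limit step -/

/-- A sequence of group elements is Sidon if the quotients of its distinct terms are distinct. -/
def IsSidonSeq {Q : Type*} [Group Q] (p : ℕ → Q) : Prop :=
  ∀ a b c d, a ≠ b → p a * (p b)⁻¹ = p c * (p d)⁻¹ → a = c ∧ b = d

theorem IsSidonSeq.injective {Q : Type*} [Group Q] {p : ℕ → Q} (hp : IsSidonSeq p) :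
    Function.Injective p := by
  intro a b hab
  by_contra hne
  obtain ⟨h1, h2⟩ := hp a b 0 0 hne (by simp [hab])
  exact hne (h1.trans h2.symm)

theorem isSidonSeq_two_pow :
    IsSidonSeq fun n => (Multiplicative.ofAdd (ULift.up.{u} ((2 : ℤ) ^ n))) := by
  intro a b c d hab h
  have h0 : (2 : ℤ) ^ a - 2 ^ b = 2 ^ c - 2 ^ d := by
    have := congrArg (fun z => (Multiplicative.toAdd z).down) h
    simpa [sub_eq_add_neg] using this
  have h1 : 2 ^ a + 2 ^ d = 2 ^ c + 2 ^ b := by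
    have : (2 : ℤ) ^ a + 2 ^ d = 2 ^ c + 2 ^ b := by linarith
    exact_mod_cast this
  -- Distinct powers of two differ by a factor of at least two; this turns the uniqueness of sums of
  -- two powers into linear arithmetic.
  have key : ∀ m n : ℕ, m = n ∨ 2 * 2 ^ m ≤ 2 ^ n ∨ 2 * 2 ^ n ≤ 2 ^ m := by
    intro m n
    simp only [← pow_succ']
    rcases lt_trichotomy m n with h | h | h
    · exact Or.inr (Or.inl (Nat.pow_le_pow_right two_pos h))
    · exact Or.inl h
    · exact Or.inr (Or.inr (Nat.pow_le_pow_right two_pos h))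
  have hac : a = c := by
    have hpos := fun n : ℕ => Nat.two_pow_pos n
    have := hpos a
    have := hpos b
    have := hpos c
    have := hpos d
    have hpow : ∀ m n : ℕ, m = n → 2 ^ m = 2 ^ n := fun _ _ h => congrArg _ h
    have := hpow a d
    have := hpow b d
    have := hpow c d
    have := hpow b c
    have := key a b
    have := key a c
    have := key a d
    have := key b c
    have := key b d
    have := key c d
    omega
  subst hac
  exact ⟨rfl, (Nat.pow_right_injective le_rfl (Nat.add_left_cancel h1)).symm⟩

namespace SparseWreath

open RegularWreathProduct

variable {H Q : Type u} [Group H] [Group Q] (p : ℕ → Q) (h : ℕ → H)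

open Classical in
/-- The function with value `h n` at `p n`, and `1` elsewhere. -/
noncomputable def base : Q → H := Function.extend p h 1

/-- The translates of `base`. -/
noncomputable def shift (q : Q) : Q → H := fun x => base p h (q⁻¹ * x)

variable {p h}

omit [Group Q] in
theorem exists_of_base_ne_one {x : Q} (hx : base p h x ≠ 1) : ∃ n, p n = x := by
  by_contra hn
  exact hx (Function.extend_apply' _ _ _ hn)

/-- A common point `x = q * p a = r * p b` forces `p a * (p b)⁻¹ = q⁻¹ * r`, and the Sidon property
recovers `a` from this quotient. -/
theorem eq_of_shift_ne_one (hp : IsSidonSeq p) {q r x y : Q} (hqr : q ≠ r)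
    (hqx : shift p h q x ≠ 1) (hrx : shift p h r x ≠ 1) (hqy : shift p h q y ≠ 1)
    (hry : shift p h r y ≠ 1) : x = y := by
  obtain ⟨a, ha⟩ := exists_of_base_ne_one hqx
  obtain ⟨b, hb⟩ := exists_of_base_ne_one hrx
  obtain ⟨c, hc⟩ := exists_of_base_ne_one hqy
  obtain ⟨d, hd⟩ := exists_of_base_ne_one hry
  have hab : a ≠ b := by
    rintro rfl
    exact hqr (inv_injective (mul_right_cancel (ha.symm.trans hb)))
  have := (hp a b c d hab (by rw [ha, hb, hc, hd]; group)).1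
  subst this
  exact mul_left_cancel (ha.symm.trans hc)

/-- Finitely many translates of `base` generate a group in `EG α`. -/
theorem EG_closure_shift (hp : IsSidonSeq p) {α : Ordinal.{u}} (hα : Order.IsSuccLimit α)
    (hH : IsLocallyEG α H) {T : Set Q} (hT : T.Finite) :
    EG α (Subgroup.closure (shift p h '' T)) := by
  -- `X` collects the points where two of the translates meet. Off `X` the values generate an
  -- abelian group at each point, so restriction to `X` has abelian kernel and its image lies in a
  -- finite product.
  let X : Set Q := ⋃ a ∈ T ×ˢ T, {x | a.1 ≠ a.2 ∧ shift p h a.1 x ≠ 1 ∧ shift p h a.2 x ≠ 1}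
  have : Finite X := by
    refine (Set.Finite.prod hT hT).biUnion fun a _ => Set.Subsingleton.finite ?_
    rintro x ⟨h1, h2, h3⟩ y ⟨_, h4, h5⟩
    exact eq_of_shift_ne_one hp h1 h2 h3 h4 h5
  let D := Subgroup.closure (shift p h '' T)
  let ev : ∀ _ : Q, (Q → H) →* H := Pi.evalMonoidHom _
  have hev : ∀ x (f : D), ev x f ∈ Subgroup.closure (ev x '' (shift p h '' T)) := fun x f =>
    (MonoidHom.map_closure (ev x) _).le (Subgroup.mem_map_of_mem _ f.2)
  let r : D →* ∀ x : X, Subgroup.closure (ev x '' (shift p h '' T)) :=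
    MonoidHom.pi fun x => ((ev x).comp D.subtype).codRestrict _ (hev x)
  refine EG_limit_of_hom hα r (EG_of_comm α ?_)
    (EG_limit_pi hα X _ fun x => hH _ ((hT.image _).image _))
  rintro ⟨f, hf⟩ ⟨g, hg⟩
  refine Subtype.ext (Subtype.ext (funext fun x => ?_))
  change f.1 x * g.1 x = g.1 x * f.1 x
  by_cases hx : x ∈ X
  · have h1 : f.1 x = 1 := congrArg Subtype.val (congrFun hf ⟨x, hx⟩)
    rw [h1, one_mul, mul_one]
  · have hcomm := Subgroup.isMulCommutative_closure (k := ev x '' (shift p h '' T)) (by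
      rintro _ ⟨_, ⟨q, hq, rfl⟩, rfl⟩ _ ⟨_, ⟨s, hs, rfl⟩, rfl⟩
      by_cases hqs : q = s
      · rw [hqs]
      · by_cases h1 : shift p h q x = 1
        · simp [ev, h1]
        · by_cases h2 : shift p h s x = 1
          · simp [ev, h2]
          · exact (hx (Set.mem_biUnion (x := (q, s)) ⟨hq, hs⟩ ⟨hqs, h1, h2⟩)).elim)
    exact setLike_mul_comm (hev x f) (hev x g)

variable (p h)

/-- The subgroup of the unrestricted wreath product generated by `base` and `Q`. -/
noncomputable def group : Subgroup (H ≀ᵣ Q) := Subgroup.zpowers ⟨base p h, 1⟩ ⊔ inl.range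

instance fg_group [Group.FG Q] : Group.FG (group p h) := by
  rw [Group.fg_iff_subgroup_fg]
  refine Subgroup.FG.sup ⟨{⟨base p h, 1⟩}, ?_⟩
    ((Group.fg_iff_subgroup_fg _).mp inferInstance)
  rw [Finset.coe_singleton, Subgroup.zpowers_eq_closure]

variable {p h}

theorem left_mem {w : H ≀ᵣ Q} (hw : w ∈ group p h) :
    w.left ∈ Subgroup.closure (Set.range (shift p h)) := by
  have hB : ∀ f ∈ Subgroup.closure (Set.range (shift p h)), ∀ q : Q,
      (fun x => f (q * x)) ∈ Subgroup.closure (Set.range (shift p h)) := by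
    intro f hf q
    let e : (Q → H) →* (Q → H) := MonoidHom.pi fun x => Pi.evalMonoidHom (fun _ => H) (q * x)
    have hle : Subgroup.closure (Set.range (shift p h)) ≤
        (Subgroup.closure (Set.range (shift p h))).comap e := by
      rw [Subgroup.closure_le]
      rintro _ ⟨r, rfl⟩
      refine Subgroup.subset_closure ⟨q⁻¹ * r, ?_⟩
      funext x
      simp [shift, e, mul_assoc]
    exact hle hf
  have : group p h ≤ ofInvariant _ hB := by
    refine sup_le ?_ ?_
    · rw [Subgroup.zpowers_le]
      exact Subgroup.subset_closure ⟨1, by funext x; simp [shift]⟩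
    · rintro _ ⟨q, rfl⟩
      exact (Subgroup.closure (Set.range (shift p h))).one_mem
  exact this hw

theorem exists_finite_of_mem_closure {f : Q → H}
    (hf : f ∈ Subgroup.closure (Set.range (shift p h))) :
    ∃ T : Set Q, T.Finite ∧ f ∈ Subgroup.closure (shift p h '' T) := by
  induction hf using Subgroup.closure_induction with
  | mem f hf =>
    obtain ⟨q, rfl⟩ := hf
    exact ⟨{q}, Set.finite_singleton q, Subgroup.subset_closure ⟨q, rfl, rfl⟩⟩
  | one => exact ⟨∅, Set.finite_empty, Subgroup.one_mem _⟩
  | mul f g _ _ hf hg =>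
    obtain ⟨S, hS, hf⟩ := hf
    obtain ⟨T, hT, hg⟩ := hg
    exact ⟨S ∪ T, hS.union hT, Subgroup.mul_mem _
      (Subgroup.closure_mono (Set.image_mono Set.subset_union_left) hf)
      (Subgroup.closure_mono (Set.image_mono Set.subset_union_right) hg)⟩
  | inv f _ hf =>
    obtain ⟨S, hS, hf⟩ := hf
    exact ⟨S, hS, Subgroup.inv_mem _ hf⟩

/-- The kernel embeds in the group generated by all translates, and finitely many of its elements
involve only finitely many translates. -/
theorem isLocallyEG_ker (hp : IsSidonSeq p) {α : Ordinal.{u}} (hα : Order.IsSuccLimit α)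
    (hH : IsLocallyEG α H) :
    IsLocallyEG α ((rightHom (D := H)).comp (group p h).subtype).ker := by
  intro t ht
  choose! T hT hmem using fun f : Q → H => exists_finite_of_mem_closure (p := p) (h := h) (f := f)
  let φ := kerLeft (group p h)
  have hφ : ∀ x, φ x ∈ Subgroup.closure (Set.range (shift p h)) := fun x => left_mem x.1.2
  refine EG_of_map_le φ (kerLeft_injective _) ?_
    (EG_closure_shift (h := h) hp hα hH (T := ⋃ x ∈ t, T (φ x)) (ht.biUnion fun x _ => hT _ (hφ x)))
  rw [MonoidHom.map_closure, Subgroup.closure_le]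
  rintro _ ⟨x, hx, rfl⟩
  exact Subgroup.closure_mono (Set.image_mono (Set.subset_biUnion_of_mem hx)) (hmem _ (hφ x))

theorem powersEG_group (hQ : ∀ a b : Q, a * b = b * a) (hp : IsSidonSeq p) {α : Ordinal.{u}}
    (hα : Order.IsSuccLimit α) (hH : IsLocallyEG α H) : PowersEG (α + 2) (group p h) := by
  have h2 : α + 2 = α + 1 + 1 := by rw [add_assoc, one_add_one_eq_two]
  rw [h2]
  refine PowersEG.of_hom ((rightHom (D := H)).comp (group p h).subtype) ?_ (.of_comm _ hQ)
  exact fun ι => (IsLocallyEG.pi hα fun _ : ι => isLocallyEG_ker hp hα hH).succ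

/-- The translates by `(p a)⁻¹` and `(p b)⁻¹` take the values `h a` and `h b` at `1` and meet
nowhere else, so their commutator is concentrated at `1`. -/
theorem commutator_le_comap_single (hp : IsSidonSeq p) (hh : Function.Surjective h) :
    commutator H ≤ (group p h).comap (single H Q) := by
  rw [commutator_eq_closure, Subgroup.closure_le]
  rintro _ ⟨x, y, rfl⟩
  obtain ⟨a, rfl⟩ := hh x
  obtain ⟨b, rfl⟩ := hh y
  by_cases hab : a = b
  · subst hab
    simp
  have hne : (p a)⁻¹ ≠ (p b)⁻¹ := fun h => hab (hp.injective (inv_injective h))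
  have hmem : ∀ q : Q, (⟨shift p h q, 1⟩ : H ≀ᵣ Q) ∈ group p h := by
    intro q
    have hq : (inl q : H ≀ᵣ Q) ∈ group p h := Subgroup.mem_sup_right ⟨q, rfl⟩
    have hb : (⟨base p h, 1⟩ : H ≀ᵣ Q) ∈ group p h :=
      Subgroup.mem_sup_left (Subgroup.mem_zpowers _)
    -- Conjugating `base` by `q` translates it.
    convert Subgroup.mul_mem _ (Subgroup.mul_mem _ hq hb) (Subgroup.inv_mem _ hq) using 1
    ext <;> simp [shift]
  have hone : ∀ n, shift p h (p n)⁻¹ 1 = h n := by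
    intro n
    simp [shift, base, hp.injective.extend_apply]
  have hcomm : single H Q (h a * h b * (h a)⁻¹ * (h b)⁻¹) =
      ⟨shift p h (p a)⁻¹, 1⟩ * ⟨shift p h (p b)⁻¹, 1⟩ * ⟨shift p h (p a)⁻¹, 1⟩⁻¹ *
        ⟨shift p h (p b)⁻¹, 1⟩⁻¹ := by
    refine RegularWreathProduct.ext (funext fun x => ?_) (by simp)
    by_cases hx : x = 1
    · subst hx
      rw [single_left_one]
      simp [hone]
    · rw [single_left_of_ne _ hx]
      by_cases h1 : shift p h (p a)⁻¹ x = 1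
      · simp [h1]
      · by_cases h2 : shift p h (p b)⁻¹ x = 1
        · simp [h2]
        · obtain ⟨c, hc⟩ := exists_of_base_ne_one h1
          obtain ⟨d, hd⟩ := exists_of_base_ne_one h2
          rw [inv_inv] at hc hd
          have := (hp a b c d hab (by rw [hc, hd]; group)).1
          subst this
          exact (hx (left_eq_mul.mp hc)).elim
  change single H Q (h a * h b * (h a)⁻¹ * (h b)⁻¹) ∈ group p h
  rw [hcomm]
  exact Subgroup.mul_mem _ (Subgroup.mul_mem _ (Subgroup.mul_mem _ (hmem _) (hmem _))
    (Subgroup.inv_mem _ (hmem _))) (Subgroup.inv_mem _ (hmem _))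

/-- The group contains a copy of the derived subgroup of `H`, and `H` is an extension of that by an
abelian group, which costs nothing at a limit. -/
theorem not_EG_group (hp : IsSidonSeq p) (hh : Function.Surjective h) {α : Ordinal.{u}}
    (hα : Order.IsSuccLimit α) (hH : ¬ EG α H) : ¬ EG α (group p h) := by
  intro hW
  refine hH (EG_limit_of_hom hα (Abelianization.of (G := H)) ?_
    (EG_of_comm α fun a b => mul_comm a b))
  rw [Abelianization.ker_of]
  refine EG_of_map_le (single H Q) ?_
    (Subgroup.map_le_iff_le_comap.mpr (commutator_le_comap_single hp hh)) hW
  intro a b hab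
  rw [← single_left_one (Q := Q) a, hab, single_left_one]

end SparseWreath

/-! ### Realizing the classes -/

theorem countable_restrictedPi {ι : Type*} [Countable ι] (G : ι → Type*) [∀ i, Group (G i)]
    [∀ i, Countable (G i)] : Countable (restrictedPi G) := by
  classical
  let e : (Σ J : Finset ι, ∀ j : J, G j) → ∀ i, G i := fun x i =>
    if h : i ∈ x.1 then x.2 ⟨i, h⟩ else 1
  refine ((Set.countable_range e).mono fun f hf => ?_).to_subtype
  refine ⟨⟨Set.Finite.toFinset hf, fun j => f j⟩, funext fun i => ?_⟩
  by_cases hi : i ∈ Set.Finite.toFinset hf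
  · simp [e, hi]
  · have h1 : f i = 1 := by
      by_contra h
      exact hi ((Set.Finite.mem_toFinset hf).mpr h)
    simp [e, hi, h1]

open Classical in
/-- The embedding of a factor into the restricted direct product. -/
noncomputable def restrictedPiSingle {ι : Type*} (G : ι → Type*) [∀ i, Group (G i)] (i : ι) :
    G i →* restrictedPi G :=
  (MonoidHom.mulSingle G i).codRestrict (restrictedPi G) fun x =>
    (Set.finite_singleton i).subset fun j hj => by
      by_contra h
      exact hj (Pi.mulSingle_eq_of_ne h x)

theorem restrictedPiSingle_injective {ι : Type*} (G : ι → Type*) [∀ i, Group (G i)] (i : ι) :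
    Function.Injective (restrictedPiSingle G i) := by
  classical
  intro a b h
  have h1 : Pi.mulSingle i a = Pi.mulSingle i b := congrArg Subtype.val h
  exact Pi.mulSingle_injective i h1

theorem countable_Iio_of_lt_omega_one {α : Ordinal.{u}} (h : α < ω₁) :
    Countable (Set.Iio α) := by
  rw [← Cardinal.mk_le_aleph0_iff, Cardinal.mk_Iio_ordinal, Cardinal.lift_le_aleph0,
    ← Cardinal.lt_aleph_one_iff]
  exact Cardinal.lt_omega_iff_card_lt.mp h

/-- If every `EG (β + 1)` with `β < α` misses some countable group in `EG (β + 2)`, and `α` is a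
countable limit ordinal, then there is a countable locally `EG α` group outside `EG α`. -/
theorem exists_countable_isLocallyEG {α : Ordinal.{u}} (hα : Order.IsSuccLimit α) (hα' : α < ω₁)
    (h : ∀ β < α, ∃ (G : Type u) (_ : Group G), Countable G ∧ EG (β + 2) G ∧ ¬ EG (β + 1) G) :
    ∃ (H : Type u) (_ : Group H), Countable H ∧ IsLocallyEG α H ∧ ¬ EG α H := by
  have := countable_Iio_of_lt_omega_one hα'
  let e := equivShrink.{u} (Set.Iio α)
  have h' : ∀ i : Shrink.{u} (Set.Iio α), ∃ (G : Type u) (_ : Group G), Countable G ∧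
      EG ((e.symm i).1 + 2) G ∧ ¬ EG ((e.symm i).1 + 1) G := fun i => h _ (e.symm i).2
  choose G hG hc hEG hnot using h'
  have : Countable (Shrink.{u} (Set.Iio α)) := e.symm.injective.countable
  refine ⟨restrictedPi G, inferInstance, countable_restrictedPi G, .pi hα fun i t _ => ?_, ?_⟩
  · refine EG_of_injective α (Subgroup.subtype _) Subtype.val_injective (EG_mono ?_ (hEG i))
    rw [← one_add_one_eq_two, ← add_assoc]
    exact (hα.add_one_lt (hα.add_one_lt (e.symm i).2)).le
  · intro hH
    obtain ⟨β, hβ, hH⟩ := (EG_limit hα _).mp hH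
    -- The factor attached to `β` is outside `EG (β + 1)`, so it keeps the product out of `EG β`.
    refine hnot (e ⟨β, hβ⟩) (EG_mono ?_
      (EG_of_injective β _ (restrictedPiSingle_injective G (e ⟨β, hβ⟩)) hH))
    rw [Equiv.symm_apply_apply]
    exact (lt_add_one β).le

open RegularWreathProduct in
theorem exists_fg_powersEG_add_one {α : Ordinal.{u}}
    (h : ∃ (G : Type u) (_ : Group G), Group.FG G ∧ PowersEG (α + 1) G ∧ ¬ EG α G) :
    ∃ (G : Type u) (_ : Group G), Group.FG G ∧ PowersEG (α + 1 + 1) G ∧ ¬ EG (α + 1) G := by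
  obtain ⟨G, _, _, h1, h2⟩ := h
  exact ⟨restricted G G, inferInstance, inferInstance, powersEG_restricted h1 h1,
    not_EG_restricted h2 h2⟩

instance : Group.FG (Multiplicative (ULift.{u} ℤ)) := by
  let f : Multiplicative ℤ →* Multiplicative (ULift.{u} ℤ) :=
    AddMonoidHom.toMultiplicative (AddEquiv.ulift.{0, u} (α := ℤ)).symm.toAddMonoidHom
  exact Group.fg_of_surjective (f := f) (AddEquiv.ulift.{0, u} (α := ℤ)).symm.surjective

open RegularWreathProduct in
theorem exists_fg_powersEG_one :
    ∃ (G : Type u) (_ : Group G), Group.FG G ∧ PowersEG 1 G ∧ ¬ EG 0 G := by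
  have h := PowersEG.of_comm (G := Multiplicative (ULift.{u} ℤ)) 0 mul_comm
  refine ⟨restricted (Multiplicative (ULift.{u} ℤ)) (Multiplicative (ULift.{u} ℤ)), inferInstance,
    inferInstance, ?_, not_EG_zero_restricted⟩
  have := powersEG_restricted h h
  rwa [zero_add] at this

/-- For every countable ordinal `α` there is a finitely generated group of class `α + 2` all of
whose restricted powers are in `EG (α + 2)`. -/
theorem exists_fg_powersEG_add_two {α : Ordinal.{u}} (hα : α < ω₁) :
    ∃ (G : Type u) (_ : Group G), Group.FG G ∧ PowersEG (α + 2) G ∧ ¬ EG (α + 1) G := by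
  have htwo : ∀ β : Ordinal.{u}, β + 2 = β + 1 + 1 := fun β => by
    rw [add_assoc, one_add_one_eq_two]
  induction α using Ordinal.limitRecOn with
  | zero =>
    rw [htwo]
    refine exists_fg_powersEG_add_one ?_
    rw [zero_add]
    exact exists_fg_powersEG_one
  | add_one α ih =>
    have := ih ((lt_add_one α).trans hα)
    rw [htwo] at this ⊢
    exact exists_fg_powersEG_add_one this
  | limit α hl ih =>
    -- `H` need not be finitely generated; the sparse wreath product over `ℤ` repairs this. It
    -- avoids `EG α`, hence also `EG (α + 1)` by finite generation.
    obtain ⟨H, _, _, hloc, hnot⟩ := exists_countable_isLocallyEG hl hα fun β hβ => by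
      obtain ⟨G, i, h1, h2, h3⟩ := ih β hβ (hβ.trans hα)
      exact ⟨G, i, Group.FG.countable G, h2.toEG, h3⟩
    obtain ⟨h, hh⟩ := exists_surjective_nat H
    have hfg := SparseWreath.fg_group
      (fun n => Multiplicative.ofAdd (ULift.up.{u} ((2 : ℤ) ^ n))) h
    exact ⟨SparseWreath.group _ h, inferInstance, hfg,
      SparseWreath.powersEG_group mul_comm isSidonSeq_two_pow hl hloc,
      fun hW => SparseWreath.not_EG_group isSidonSeq_two_pow hh hl hnot (EG_limit_of_fg hl hW)⟩

theorem corollary1p6 :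
    {α : Ordinal.{u} | ∃ (G : Type u) (_ : Group G),
        Countable G ∧ IsElementaryAmenable G ∧ elementaryClass G = α} =
      {α | ∃ β < ω₁, α = β + 1} ∪ {0} ∧
    {α : Ordinal.{u} | ∃ (G : Type u) (_ : Group G),
        Group.FG G ∧ IsElementaryAmenable G ∧ elementaryClass G = α} =
      {α | ∃ β < ω₁, α = β + 2} ∪ {0, 1} := by
  have htwo : ∀ β : Ordinal.{u}, β + 2 = β + 1 + 1 := fun β => by
    rw [add_assoc, one_add_one_eq_two]
  have hcount : ∀ (G : Type u) [Group G] [Countable G], IsElementaryAmenable G →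
      elementaryClass G = 0 ∨ ∃ β < ω₁, elementaryClass G = β + 1 := by
    intro G _ _ h
    obtain ⟨γ, hγ, hG⟩ := exists_EG_lt_omega_one h.EG_elementaryClass
    have hlt := (elementaryClass_le hG).trans_lt hγ
    rcases Ordinal.zero_or_succ_or_isSuccLimit (elementaryClass G) with h0 | ⟨β, hβ⟩ | hl
    · exact Or.inl h0
    · rw [Order.succ_eq_add_one] at hβ
      exact Or.inr ⟨β, (lt_add_one β).trans (hβ ▸ hlt), hβ.symm⟩
    · exact (not_isSuccLimit_elementaryClass h hl).elim
  have hzero : ∃ (G : Type u) (_ : Group G), Group.FG G ∧ IsElementaryAmenable G ∧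
      elementaryClass G = 0 :=
    have h := EG_of_comm (G := PUnit) 0 mul_comm
    ⟨PUnit, inferInstance, inferInstance, h.isElementaryAmenable,
      le_antisymm (elementaryClass_le h) zero_le⟩
  have hone : ∃ (G : Type u) (_ : Group G), Group.FG G ∧ IsElementaryAmenable G ∧
      elementaryClass G = 1 := by
    obtain ⟨G, i, h1, h2, h3⟩ := exists_fg_powersEG_one.{u}
    rw [← zero_add (1 : Ordinal)] at h2 ⊢
    exact ⟨G, i, h1, h2.toEG.isElementaryAmenable, elementaryClass_eq_add_one h2.toEG h3⟩
  have htwo' : ∀ β < ω₁, ∃ (G : Type u) (_ : Group G), Group.FG G ∧ IsElementaryAmenable G ∧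
      elementaryClass G = β + 2 := by
    intro β hβ
    obtain ⟨G, i, h1, h2, h3⟩ := exists_fg_powersEG_add_two hβ
    rw [htwo] at h2 ⊢
    exact ⟨G, i, h1, h2.toEG.isElementaryAmenable, elementaryClass_eq_add_one h2.toEG h3⟩
  have hfg : ∀ {α : Ordinal.{u}}, (∃ (G : Type u) (_ : Group G), Group.FG G ∧
      IsElementaryAmenable G ∧ elementaryClass G = α) → ∃ (G : Type u) (_ : Group G),
        Countable G ∧ IsElementaryAmenable G ∧ elementaryClass G = α := by
    rintro α ⟨G, i, h1, h2⟩
    exact ⟨G, i, Group.FG.countable G, h2⟩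
  refine ⟨Set.Subset.antisymm ?_ ?_, Set.Subset.antisymm ?_ ?_⟩
  · rintro _ ⟨G, _, _, h, rfl⟩
    exact (hcount G h).symm
  · rintro _ (⟨β, hβ, rfl⟩ | rfl)
    · rcases Ordinal.zero_or_succ_or_isSuccLimit β with rfl | ⟨β, rfl⟩ | hl
      · rw [zero_add]
        exact hfg hone
      · rw [Order.succ_eq_add_one] at hβ ⊢
        rw [← htwo]
        exact hfg (htwo' β ((lt_add_one β).trans hβ))
      -- Limit plus one is the case where no finitely generated group can serve; `H` itself has this
      -- class.
      · obtain ⟨H, i, hc, hloc, hnot⟩ := exists_countable_isLocallyEG hl hβ fun γ hγ => by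
          obtain ⟨G, i, h1, h2, h3⟩ := exists_fg_powersEG_add_two (hγ.trans hβ)
          exact ⟨G, i, Group.FG.countable G, h2.toEG, h3⟩
        exact ⟨H, i, hc, hloc.succ.isElementaryAmenable, elementaryClass_eq_add_one hloc.succ hnot⟩
    · exact hfg hzero
  · rintro _ ⟨G, _, _, h, rfl⟩
    have := Group.FG.countable G
    rcases hcount G h with h0 | ⟨β, hβ, hG⟩
    · exact Or.inr (Or.inl h0)
    · rcases Ordinal.zero_or_succ_or_isSuccLimit β with rfl | ⟨β, rfl⟩ | hl
      · exact Or.inr (Or.inr (hG.trans (zero_add 1)))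
      · rw [Order.succ_eq_add_one] at hβ hG
        exact Or.inl ⟨β, (lt_add_one β).trans hβ, hG.trans (htwo β).symm⟩
      · have hEG := h.EG_elementaryClass
        rw [hG] at hEG
        have := elementaryClass_le (EG_limit_of_fg hl hEG)
        rw [hG] at this
        exact ((lt_add_one β).not_ge this).elim
  · rintro _ (⟨β, hβ, rfl⟩ | rfl | rfl)
    · exact htwo' β hβ
    · exact hzero
    · exact hone
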